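/- Let $N\ge 3$. For $0<\gamma<\pi$ let $$\mathcal C_\gamma=\{x\in\mathbb R^N\setminus\{0\} : x_N=|x|\cos\theta_1 \text{ with } 0\le\theta_1<\gamma\}$$ be the circular cone with slot $\gamma$ and let $\mathcal D_\gamma=\mathcal C_\gamma\cap S^{N-1}$ be the corresponding open spherical cap. Let $\lambda_1(\gamma)$ be the first Dirichlet eigenvalue of the spherical Laplacian on $\mathcal D_\gamma$, i.e. the smallest $\lambda\in\mathbb R$ for which there is a function $u\not\equiv0$ in $C^2(\mathcal D_\gamma)\cap C(\overline{\mathcal D_\gamma})$ with $-\Delta_{S^{N-1}}u=\lambda u$ in $\mathcal D_\gamma$ and $u=0$ on $\partial\mathcal D_\gamma$ (such a smallest $\lambda$ exists for every $\gamma\in(0,\pi)$). Let $B_1$ be the first positive zero of the Bessel function $J_{(N-3)/2}$ of the first kind (which exists). Then $$\lim_{\gamma\to0^+}\frac{\lambda_1(\gamma)\,\gamma^2}{B_1^2}=1 .$$ -/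

import Mathlib

open Filter Topology

noncomputable section

/-- The unit vector along the last coordinate axis `x_N` of `ℝ^N`. -/
def northPole (N : ℕ) : EuclideanSpace ℝ (Fin N) :=
  WithLp.toLp 2 (fun i => if (i : ℕ) + 1 = N then 1 else 0)

/-- The circular cone of slot `γ` in `ℝ^N`: the nonzero `x` whose first spherical angle `θ₁`
(`x_N = ‖x‖ cos θ₁`, `0 ≤ θ₁ ≤ π`) is less than `γ`. -/
def circularCone (N : ℕ) (γ : ℝ) : Set (EuclideanSpace ℝ (Fin N)) :=
  {x | x ≠ 0 ∧ InnerProductGeometry.angle x (northPole N) < γ}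

/-- The spherical cap cut out of the unit sphere `S^{N-1}` by the cone of slot `γ`. -/
def sphericalCap (N : ℕ) (γ : ℝ) : Set (EuclideanSpace ℝ (Fin N)) :=
  circularCone N γ ∩ Metric.sphere 0 1

/-- The extension, homogeneous of degree `0`, of a function on the unit sphere
(only the values of `u` on the unit sphere matter at points `x ≠ 0`). -/
def homogeneousExtension {N : ℕ} (u : EuclideanSpace ℝ (Fin N) → ℝ) :
    EuclideanSpace ℝ (Fin N) → ℝ :=
  fun x => u (‖x‖⁻¹ • x)

/-- The spherical Laplacian (Laplace–Beltrami operator of `S^{N-1}`) at a point `ω` of the unit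
sphere: the Euclidean Laplacian of the extension homogeneous of degree `0`. In polar coordinates
`Δ = ∂_r² + (N-1)/r ∂_r + r⁻² Δ_S`, and the radial terms vanish on this extension. -/
def sphericalLaplacian {N : ℕ} (u : EuclideanSpace ℝ (Fin N) → ℝ)
    (ω : EuclideanSpace ℝ (Fin N)) : ℝ :=
  (Laplacian.laplacian (homogeneousExtension u) : EuclideanSpace ℝ (Fin N) → ℝ) ω

/-- `μ` is a Dirichlet eigenvalue of `-Δ_S` on the relatively open subset `D` of the unit sphere:
there is a function `u`, not identically zero on `D`, of class `C²` on `D`, continuous on the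
closure of `D`, with `-Δ_S u = μ u` in `D` and `u = 0` on the boundary of `D` relative to the
sphere, which is `closure D \ D`. (Being `C²` on `D` is expressed by the `C²` regularity of the
homogeneous extension on the open cone over `D`.) -/
def IsSphericalDirichletEigenvalue {N : ℕ} (D : Set (EuclideanSpace ℝ (Fin N))) (μ : ℝ) : Prop :=
  ∃ u : EuclideanSpace ℝ (Fin N) → ℝ,
    ContDiffOn ℝ 2 (homogeneousExtension u) {x | x ≠ 0 ∧ ‖x‖⁻¹ • x ∈ D} ∧
    ContinuousOn u (closure D) ∧
    (∃ ω ∈ D, u ω ≠ 0) ∧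
    (∀ ω ∈ D, -sphericalLaplacian u ω = μ * u ω) ∧
    (∀ ω ∈ closure D \ D, u ω = 0)

/-- The first (smallest) Dirichlet eigenvalue `λ₁(γ)` of the spherical Laplacian on the cap. -/
def firstCapEigenvalue (N : ℕ) (γ : ℝ) : ℝ :=
  sInf {μ : ℝ | IsSphericalDirichletEigenvalue (sphericalCap N γ) μ}

/-- The Bessel function of the first kind `J_ν`, for real order `ν ≥ 0` and `x > 0`. -/
def besselJ (ν x : ℝ) : ℝ :=
  (x / 2) ^ ν *
    ∑' k : ℕ, (-1 : ℝ) ^ k / ((k.factorial : ℝ) * Real.Gamma ((k : ℝ) + ν + 1)) *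
      (x / 2) ^ (2 * k)

end

/-! With `m = (N - 1) / 2` and `s = (1 - x_N) / 2`, the eigenvalue equation for a function of height
alone becomes the hypergeometric equation `s (1 - s) f'' + m (1 - 2 s) f' + l f = 0`. Its solution
regular at the pole is `gegenbauerSeries m l 1`. The cap of slot `γ` is `s < (1 - cos γ) / 2 ≈ γ ^ 2
/ 4`.

Putting `s = ε y` with `ε = γ ^ 2` replaces the parameters `(l, 1)` by `(l γ ^ 2, γ ^ 2)`, and the
boundary moves to `y ≈ 1 / 4`. At `ε = 0` the equation is Bessel's: `gegenbauerSeries m 1 0 (x ^ 2 /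
4)` is `J_{m-1}(x)` up to a positive factor (`besselJ_eq`). Since the series is jointly continuous
in `(l, ε, y)`, also at `ε = 0` (`continuousAt_gegenbauerSeries`), the rescaled eigenvalue tends to
the `q` with `q / 4 = B₁ ^ 2 / 4`.

The first eigenvalue is identified without spectral theory. A zonal solution positive on the closed
cap bounds every eigenvalue from below, by the maximum principle for a quotient
(`le_of_isSphericalDirichletEigenvalue`). The least parameter for which the solution loses
positivity gives a zero exactly on the boundary (`exists_first_parameter`), hence an eigenfunction.
Existence of that parameter, and of `B₁`, rests on the Bessel series having a zero, which a Riccati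
argument provides (`exists_gegenbauerSeries_nonpos`). -/

/-! ### The power series family: majorants, convergence, joint continuity. -/

/-- Coefficients of the power series solution, with value `1` at `0`, of the equation
`y (1 - ε y) f'' + m (1 - 2 ε y) f' + l f = 0`. -/
noncomputable def gegenbauerCoeff (m l ε : ℝ) : ℕ → ℝ
  | 0 => 1
  | k + 1 => (ε * (k * (k - 1 + 2 * m)) - l) / ((k + 1) * (k + m)) * gegenbauerCoeff m l ε k

/-- The power series solution, with value `1` at `0`, of the equation
`y (1 - ε y) f'' + m (1 - 2 ε y) f' + l f = 0`. -/
noncomputable def gegenbauerSeries (m l ε y : ℝ) : ℝ := ∑' k, gegenbauerCoeff m l ε k * y ^ k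

theorem natCast_mul_sub_one_add_nonneg {m : ℝ} (hm : 1 ≤ m) (k : ℕ) :
    0 ≤ (k : ℝ) * (k - 1 + 2 * m) := by
  have hk : (0 : ℝ) ≤ k := k.cast_nonneg
  exact mul_nonneg hk (by linarith)

theorem natCast_add_one_mul_add_pos {m : ℝ} (hm : 1 ≤ m) (k : ℕ) :
    0 < ((k : ℝ) + 1) * (k + m) := by
  have hk : (0 : ℝ) ≤ k := k.cast_nonneg
  exact mul_pos (by linarith) (by linarith)

/-- Replacing `l` by `-L` and `ε` by `E` makes both terms of the recursion's numerator nonnegative,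
so the family contains its own majorants, uniform over a box of parameters. -/
theorem abs_gegenbauerCoeff_le {m l ε L E : ℝ} (hm : 1 ≤ m) (hl : |l| ≤ L) (hε : |ε| ≤ E) (k : ℕ) :
    |gegenbauerCoeff m l ε k| ≤ gegenbauerCoeff m (-L) E k := by
  induction k with
  | zero => simp [gegenbauerCoeff]
  | succ k ih =>
    have h1 := natCast_mul_sub_one_add_nonneg hm k
    have h2 := natCast_add_one_mul_add_pos hm k
    have hE : 0 ≤ E := (abs_nonneg _).trans hε
    have hL : 0 ≤ L := (abs_nonneg _).trans hl
    rw [gegenbauerCoeff, gegenbauerCoeff, abs_mul, abs_div, abs_of_pos h2]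
    refine mul_le_mul ?_ ih (abs_nonneg _) (div_nonneg (by nlinarith) h2.le)
    refine div_le_div_of_nonneg_right ?_ h2.le
    refine (abs_sub _ _).trans ?_
    rw [abs_mul, abs_of_nonneg h1, sub_neg_eq_add]
    gcongr

theorem gegenbauerCoeff_neg_pos {m L E : ℝ} (hm : 1 ≤ m) (hL : 0 < L) (hE : 0 ≤ E) (k : ℕ) :
    0 < gegenbauerCoeff m (-L) E k := by
  induction k with
  | zero => simp [gegenbauerCoeff]
  | succ k ih =>
    have h1 := natCast_mul_sub_one_add_nonneg hm k
    exact mul_pos (div_pos (by nlinarith) (natCast_add_one_mul_add_pos hm k)) ih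

theorem tendsto_gegenbauerCoeff_ratio (m l ε : ℝ) :
    Tendsto (fun k : ℕ => (ε * ((k : ℝ) * (k - 1 + 2 * m)) - l) / ((k + 1) * (k + m)))
      atTop (𝓝 ε) := by
  have hi : Tendsto (fun k : ℕ => ((k : ℝ))⁻¹) atTop (𝓝 0) := tendsto_inv_atTop_nhds_zero_nat
  have h : Tendsto (fun k : ℕ => (ε * (1 * (1 - (k : ℝ)⁻¹ + 2 * m * (k : ℝ)⁻¹))
      - l * ((k : ℝ)⁻¹ * (k : ℝ)⁻¹)) / ((1 + (k : ℝ)⁻¹) * (1 + m * (k : ℝ)⁻¹)))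
      atTop (𝓝 ((ε * (1 * (1 - 0 + 2 * m * 0)) - l * (0 * 0)) / ((1 + 0) * (1 + m * 0)))) := by
    refine Tendsto.div ?_ ?_ (by simp)
    · exact (((tendsto_const_nhds.sub hi).add (hi.const_mul _)).const_mul 1 |>.const_mul ε).sub
        ((hi.mul hi).const_mul l)
    · exact (tendsto_const_nhds.add hi).mul (tendsto_const_nhds.add (hi.const_mul m))
  have e : (ε * (1 * (1 - 0 + 2 * m * 0)) - l * (0 * 0)) / ((1 + 0) * (1 + m * 0)) = ε := by simp
  rw [e] at h
  refine h.congr' ?_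
  filter_upwards [eventually_ge_atTop 1] with k hk
  have hk : (k : ℝ) ≠ 0 := by positivity
  rw [← mul_div_mul_left _ _ (mul_ne_zero hk hk)]
  congr 1 <;> field_simp

theorem summable_gegenbauerCoeff_neg {m L E R : ℝ} (hm : 1 ≤ m) (hL : 0 < L) (hE : 0 ≤ E)
    (hR : 0 < R) (hER : E * R < 1) : Summable fun k => gegenbauerCoeff m (-L) E k * R ^ k := by
  have hpos : ∀ k, 0 < gegenbauerCoeff m (-L) E k * R ^ k := fun k =>
    mul_pos (gegenbauerCoeff_neg_pos hm hL hE k) (pow_pos hR k)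
  refine summable_of_ratio_test_tendsto_lt_one hER (Eventually.of_forall fun k => (hpos k).ne') ?_
  refine ((tendsto_gegenbauerCoeff_ratio m (-L) E).mul_const R).congr fun k => ?_
  rw [Real.norm_of_nonneg (hpos _).le, Real.norm_of_nonneg (hpos _).le, gegenbauerCoeff, pow_succ]
  have := (gegenbauerCoeff_neg_pos hm hL hE k).ne'
  have := (pow_pos hR k).ne'
  field_simp

theorem abs_gegenbauerCoeff_mul_pow_le {m l ε L E R y : ℝ} (hm : 1 ≤ m) (hl : |l| ≤ L)
    (hε : |ε| ≤ E) (hy : |y| ≤ R) (k : ℕ) :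
    ‖gegenbauerCoeff m l ε k * y ^ k‖ ≤ gegenbauerCoeff m (-L) E k * R ^ k := by
  have h := abs_gegenbauerCoeff_le hm hl hε k
  rw [Real.norm_eq_abs, abs_mul, abs_pow]
  exact mul_le_mul h (pow_le_pow_left₀ (abs_nonneg _) hy k) (by positivity)
    ((abs_nonneg _).trans h)

theorem exists_bounds_of_abs_mul_lt_one {ε y : ℝ} (h : |ε * y| < 1) :
    ∃ E R, |ε| < E ∧ |y| < R ∧ E * R < 1 := by
  rw [abs_mul] at h
  have hc : Tendsto (fun t : ℝ => (|ε| + t) * (|y| + t)) (𝓝[>] 0) (𝓝 ((|ε| + 0) * (|y| + 0))) :=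
    (Continuous.tendsto (by fun_prop) 0).mono_left nhdsWithin_le_nhds
  have hlt : (|ε| + 0) * (|y| + 0) < 1 := by simpa using h
  obtain ⟨t, ht, ht0⟩ := ((hc.eventually_lt_const hlt).and self_mem_nhdsWithin).exists
  exact ⟨_, _, lt_add_of_pos_right _ ht0, lt_add_of_pos_right _ ht0, ht⟩

theorem summable_gegenbauerSeries {m l ε y : ℝ} (hm : 1 ≤ m) (h : |ε * y| < 1) :
    Summable fun k => gegenbauerCoeff m l ε k * y ^ k := by
  obtain ⟨E, R, hE, hR, hER⟩ := exists_bounds_of_abs_mul_lt_one h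
  -- The `+ 1` makes `L` positive, so that no term of the majorant vanishes, as the ratio test
  -- requires.
  refine Summable.of_norm_bounded (summable_gegenbauerCoeff_neg (L := |l| + 1) hm (by positivity)
    ((abs_nonneg _).trans hE.le) ((abs_nonneg _).trans_lt hR) hER) fun k => ?_
  exact abs_gegenbauerCoeff_mul_pow_le hm (by linarith) hE.le hR.le k

theorem continuous_gegenbauerCoeff (m : ℝ) (k : ℕ) :
    Continuous fun p : ℝ × ℝ => gegenbauerCoeff m p.1 p.2 k := by
  induction k with
  | zero => exact continuous_const
  | succ k ih =>
    simp only [gegenbauerCoeff]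
    exact Continuous.mul (by fun_prop) ih

/-- Allowing `ε = 0` is what permits the passage to the Bessel limit. -/
theorem continuousAt_gegenbauerSeries {m : ℝ} (hm : 1 ≤ m) {p : ℝ × ℝ × ℝ}
    (h : |p.2.1 * p.2.2| < 1) :
    ContinuousAt (fun p : ℝ × ℝ × ℝ => gegenbauerSeries m p.1 p.2.1 p.2.2) p := by
  obtain ⟨E, R, hE, hR, hER⟩ := exists_bounds_of_abs_mul_lt_one h
  have ho : IsOpen {q : ℝ × ℝ × ℝ | |q.1| < |p.1| + 1 ∧ |q.2.1| < E ∧ |q.2.2| < R} :=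
    IsOpen.and (isOpen_lt (by fun_prop) (by fun_prop))
      (IsOpen.and (isOpen_lt (by fun_prop) (by fun_prop)) (isOpen_lt (by fun_prop) (by fun_prop)))
  refine ContinuousOn.continuousAt ?_ (ho.mem_nhds ⟨by linarith, hE, hR⟩)
  refine continuousOn_tsum (fun k => ?_)
    (summable_gegenbauerCoeff_neg (L := |p.1| + 1) hm (by positivity)
      ((abs_nonneg _).trans hE.le) ((abs_nonneg _).trans_lt hR) hER)
    fun k q hq => abs_gegenbauerCoeff_mul_pow_le hm hq.1.le hq.2.1.le hq.2.2.le k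
  refine Continuous.continuousOn (Continuous.mul ?_ (by fun_prop))
  exact (continuous_gegenbauerCoeff m k).comp (by fun_prop : Continuous
    fun q : ℝ × ℝ × ℝ => (q.1, q.2.1))

/-! ### Derivatives, scaling and the differential equation. -/

/-- Differentiating the equation gives one of the same type with `m + 1` and `l - 2 m ε`, so the
derivative of a member of the family is a multiple of another member. -/
theorem succ_mul_gegenbauerCoeff_succ {m : ℝ} (hm : 1 ≤ m) (l ε : ℝ) (k : ℕ) :
    (k + 1) * gegenbauerCoeff m l ε (k + 1) =
      -l / m * gegenbauerCoeff (m + 1) (l - 2 * m * ε) ε k := by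
  induction k with
  | zero => simp [gegenbauerCoeff]
  | succ k ih =>
    have hk : (0 : ℝ) ≤ k := k.cast_nonneg
    have h1 : (k : ℝ) + 1 ≠ 0 := by positivity
    have h2 : (k : ℝ) + 1 + 1 ≠ 0 := by positivity
    have h3 : (k : ℝ) + 1 + m ≠ 0 := by positivity
    rw [gegenbauerCoeff.eq_2 m, gegenbauerCoeff.eq_2 (m + 1), mul_left_comm (-l / m), ← ih]
    push_cast
    have h4 : (k : ℝ) + (m + 1) ≠ 0 := by positivity
    field_simp
    ring

theorem gegenbauerSeries_zero (m l ε : ℝ) : gegenbauerSeries m l ε 0 = 1 := by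
  rw [gegenbauerSeries, tsum_eq_single 0 (fun k hk => by simp [hk])]
  simp [gegenbauerCoeff]

theorem gegenbauerCoeff_zero_left {m : ℝ} (ε : ℝ) (k : ℕ) :
    gegenbauerCoeff m 0 ε (k + 1) = 0 := by
  induction k with
  | zero => simp [gegenbauerCoeff]
  | succ k ih => rw [gegenbauerCoeff, ih, mul_zero]

theorem gegenbauerSeries_zero_left (m ε y : ℝ) : gegenbauerSeries m 0 ε y = 1 := by
  rw [gegenbauerSeries, tsum_eq_single 0 (fun k hk => ?_)]
  · simp [gegenbauerCoeff]
  · obtain ⟨j, rfl⟩ := Nat.exists_eq_succ_of_ne_zero hk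
    simp [gegenbauerCoeff_zero_left]

theorem gegenbauerCoeff_scale (m l ε c : ℝ) (k : ℕ) :
    gegenbauerCoeff m (c * l) (c * ε) k = c ^ k * gegenbauerCoeff m l ε k := by
  induction k with
  | zero => simp [gegenbauerCoeff]
  | succ k ih => rw [gegenbauerCoeff, gegenbauerCoeff, ih]; ring

theorem gegenbauerSeries_scale (m l ε c y : ℝ) :
    gegenbauerSeries m (c * l) (c * ε) y = gegenbauerSeries m l ε (c * y) := by
  simp only [gegenbauerSeries, gegenbauerCoeff_scale, mul_pow]
  exact tsum_congr fun k => by ring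

/-- The derivative of `gegenbauerSeries m l ε`. -/
noncomputable def gegenbauerDeriv (m l ε y : ℝ) : ℝ :=
  -l / m * gegenbauerSeries (m + 1) (l - 2 * m * ε) ε y

/-- The second derivative of `gegenbauerSeries m l ε`. -/
noncomputable def gegenbauerDeriv₂ (m l ε y : ℝ) : ℝ :=
  -l / m * gegenbauerDeriv (m + 1) (l - 2 * m * ε) ε y

theorem hasSum_gegenbauerDeriv {m l ε y : ℝ} (hm : 1 ≤ m) (h : |ε * y| < 1) :
    HasSum (fun k : ℕ => (k + 1) * gegenbauerCoeff m l ε (k + 1) * y ^ k)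
      (gegenbauerDeriv m l ε y) := by
  have := ((summable_gegenbauerSeries (m := m + 1) (l := l - 2 * m * ε) (by linarith) h).hasSum
    ).mul_left (-l / m)
  refine this.congr_fun fun k => ?_
  rw [succ_mul_gegenbauerCoeff_succ hm, mul_assoc]

theorem hasDerivAt_gegenbauerSeries {m l ε y : ℝ} (hm : 1 ≤ m) (h : |ε * y| < 1) :
    HasDerivAt (gegenbauerSeries m l ε) (gegenbauerDeriv m l ε y) y := by
  obtain ⟨E, R, hE, hR, hER⟩ := exists_bounds_of_abs_mul_lt_one h
  have hE0 : 0 ≤ E := (abs_nonneg _).trans hE.le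
  have hR0 : 0 < R := (abs_nonneg _).trans_lt hR
  have hs := hasSum_gegenbauerDeriv (l := l) hm h
  have hs0 : HasSum (fun k : ℕ => gegenbauerCoeff m l ε k * (k * y ^ (k - 1)))
      (gegenbauerDeriv m l ε y) := by
    rw [← hasSum_nat_add_iff' 1]
    simp only [Finset.range_one, Finset.sum_singleton, Nat.cast_zero, zero_mul, mul_zero, sub_zero,
      Nat.add_sub_cancel]
    exact hs.congr_fun fun k => by push_cast; ring
  have hu : Summable fun k : ℕ => gegenbauerCoeff m (-(|l| + 1)) E k * (k * R ^ (k - 1)) := by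
    rw [← summable_nat_add_iff 1]
    have := (hasSum_gegenbauerDeriv (m := m) (l := -(|l| + 1)) (ε := E) (y := R) hm
      (by rwa [abs_of_nonneg (by positivity)])).summable
    refine this.congr fun k => ?_
    simp only [Nat.add_sub_cancel]
    push_cast; ring
  have key := hasDerivAt_tsum_of_isPreconnected (t := Metric.ball (0 : ℝ) R) hu Metric.isOpen_ball
    (convex_ball (0 : ℝ) R).isPreconnected
    (g := fun k z => gegenbauerCoeff m l ε k * z ^ k)
    (g' := fun k z => gegenbauerCoeff m l ε k * (k * z ^ (k - 1))) (y₀ := y) (y := y)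
    (fun k z _ => (hasDerivAt_pow k z).const_mul _) (fun k z hz => ?_)
    (by simpa using hR) (summable_gegenbauerSeries hm h) (by simpa using hR)
  · rw [hs0.tsum_eq] at key
    exact key
  · have hb := abs_gegenbauerCoeff_le (L := |l| + 1) hm (by linarith) hE.le (l := l) k
    have hz : |z| ≤ R := by simpa using (mem_ball_zero_iff.1 hz).le
    rw [Real.norm_eq_abs, abs_mul, abs_mul, abs_pow, Nat.abs_cast]
    exact mul_le_mul hb (by gcongr) (by positivity) ((abs_nonneg _).trans hb)

theorem hasDerivAt_gegenbauerDeriv {m l ε y : ℝ} (hm : 1 ≤ m) (h : |ε * y| < 1) :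
    HasDerivAt (gegenbauerDeriv m l ε) (gegenbauerDeriv₂ m l ε y) y :=
  (hasDerivAt_gegenbauerSeries (by linarith) h).const_mul _

theorem gegenbauerSeries_ode {m l ε y : ℝ} (hm : 1 ≤ m) (h : |ε * y| < 1) :
    y * (1 - ε * y) * gegenbauerDeriv₂ m l ε y + m * (1 - 2 * ε * y) * gegenbauerDeriv m l ε y
      + l * gegenbauerSeries m l ε y = 0 := by
  have h0 := (summable_gegenbauerSeries (l := l) hm h).hasSum
  have h1 := hasSum_gegenbauerDeriv (l := l) hm h
  have h2 : HasSum (fun k : ℕ => (k + 1) * (k + 2) * gegenbauerCoeff m l ε (k + 2) * y ^ k)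
      (gegenbauerDeriv₂ m l ε y) := by
    refine ((hasSum_gegenbauerDeriv (m := m + 1) (l := l - 2 * m * ε) (by linarith) h).mul_left
      (-l / m)).congr_fun fun k => ?_
    have := succ_mul_gegenbauerCoeff_succ hm l ε (k + 1)
    push_cast at this
    linear_combination (k + 1) * y ^ k * this
  have h1y : HasSum (fun k : ℕ => k * gegenbauerCoeff m l ε k * y ^ k)
      (y * gegenbauerDeriv m l ε y) := by
    rw [← hasSum_nat_add_iff' 1]
    simp only [Finset.range_one, Finset.sum_singleton, Nat.cast_zero, zero_mul, sub_zero]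
    exact (h1.mul_left y).congr_fun fun k => by push_cast; ring
  have h2y : HasSum (fun k : ℕ => k * (k + 1) * gegenbauerCoeff m l ε (k + 1) * y ^ k)
      (y * gegenbauerDeriv₂ m l ε y) := by
    rw [← hasSum_nat_add_iff' 1]
    simp only [Finset.range_one, Finset.sum_singleton, Nat.cast_zero, zero_mul, sub_zero]
    exact (h2.mul_left y).congr_fun fun k => by push_cast; ring
  have h2yy : HasSum (fun k : ℕ => k * (k - 1) * gegenbauerCoeff m l ε k * y ^ k)
      (y * (y * gegenbauerDeriv₂ m l ε y)) := by
    rw [← hasSum_nat_add_iff' 1]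
    simp only [Finset.range_one, Finset.sum_singleton, Nat.cast_zero, zero_mul, sub_zero]
    exact (h2y.mul_left y).congr_fun fun k => by push_cast; ring
  have hsum := ((h2y.sub (h2yy.mul_left ε)).add
    ((h1.mul_left m).sub (h1y.mul_left (2 * m * ε)))).add (h0.mul_left l)
  have hz := hsum.unique (hasSum_zero.congr_fun fun k => ?_)
  · rw [gegenbauerSeries]
    linear_combination hz
  · have hk := (natCast_add_one_mul_add_pos hm k).ne'
    have hr : (k + 1) * (k + m) * gegenbauerCoeff m l ε (k + 1) =
        (ε * (k * (k - 1 + 2 * m)) - l) * gegenbauerCoeff m l ε k := by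
      rw [gegenbauerCoeff]; field_simp
    linear_combination y ^ k * hr

theorem isOpen_abs_mul_lt_one (ε : ℝ) : IsOpen {y : ℝ | |ε * y| < 1} :=
  isOpen_lt (by fun_prop) continuous_const

theorem contDiffOn_gegenbauerSeries (n : ℕ) {m : ℝ} (hm : 1 ≤ m) (l ε : ℝ) :
    ContDiffOn ℝ n (gegenbauerSeries m l ε) {y | |ε * y| < 1} := by
  -- Each derivative raises `m` and shifts `l`, so both must vary in the induction.
  induction n generalizing m l with
  | zero =>
    exact contDiffOn_zero.2 fun y hy =>
      (hasDerivAt_gegenbauerSeries hm hy).continuousAt.continuousWithinAt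
  | succ n ih =>
    push_cast
    rw [contDiffOn_succ_iff_deriv_of_isOpen (isOpen_abs_mul_lt_one ε)]
    refine ⟨fun y hy => (hasDerivAt_gegenbauerSeries hm hy).differentiableAt.differentiableWithinAt,
      by simp, ?_⟩
    refine ContDiffOn.congr (f := gegenbauerDeriv m l ε) ?_
      fun y hy => (hasDerivAt_gegenbauerSeries hm hy).deriv
    exact contDiffOn_const.mul (ih (by linarith) _)

/-! ### Monotonicity and first zeros of the series. -/

/-- In Sturm–Liouville form, `((y (1 - ε y)) ^ m f')' = -l (y (1 - ε y)) ^ (m - 1) f`. The flux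
starts at `0` and strictly decreases while `f > 0`. In particular a first zero is a transversal
crossing. -/
theorem gegenbauerSeries_deriv_neg {m l ε y₀ : ℝ} (hm : 1 ≤ m) (hl : 0 < l) (hε : 0 ≤ ε)
    (hy₀ : 0 < y₀) (hεy : ε * y₀ < 1) (hpos : ∀ y ∈ Set.Ioo 0 y₀, 0 < gegenbauerSeries m l ε y) :
    gegenbauerDeriv m l ε y₀ < 0 := by
  have hlt : ∀ y ∈ Set.Icc 0 y₀, ε * y < 1 := fun y hy =>
    (mul_le_mul_of_nonneg_left hy.2 hε).trans_lt hεy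
  have habs : ∀ y ∈ Set.Icc 0 y₀, |ε * y| < 1 := fun y hy => by
    rw [abs_of_nonneg (mul_nonneg hε hy.1)]; exact hlt y hy
  have hd : ∀ y ∈ Set.Icc 0 y₀, HasDerivAt
      (fun y => (y * (1 - ε * y)) ^ m * gegenbauerDeriv m l ε y)
      ((1 * (1 - ε * y) + y * (-(ε * 1))) * m * (y * (1 - ε * y)) ^ (m - 1) *
        gegenbauerDeriv m l ε y + (y * (1 - ε * y)) ^ m * gegenbauerDeriv₂ m l ε y) y := by
    intro y hy
    have h1 : HasDerivAt (fun y => y * (1 - ε * y)) (1 * (1 - ε * y) + y * (-(ε * 1))) y :=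
      (hasDerivAt_id y).mul (((hasDerivAt_id y).const_mul ε).const_sub 1)
    exact (h1.rpow_const (Or.inr hm)).mul (hasDerivAt_gegenbauerDeriv hm (habs y hy))
  have hanti : StrictAntiOn (fun y => (y * (1 - ε * y)) ^ m * gegenbauerDeriv m l ε y)
      (Set.Icc 0 y₀) := by
    refine strictAntiOn_of_deriv_neg (convex_Icc _ _)
      (fun y hy => (hd y hy).continuousAt.continuousWithinAt) fun y hy => ?_
    rw [interior_Icc] at hy
    have hy' := Set.Ioo_subset_Icc_self hy
    rw [(hd y hy').deriv]
    have hb : 0 < y * (1 - ε * y) := mul_pos hy.1 (by linarith [hlt y hy'])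
    have hbm : (y * (1 - ε * y)) ^ m = (y * (1 - ε * y)) ^ (m - 1) * (y * (1 - ε * y)) := by
      rw [Real.rpow_sub_one hb.ne', div_mul_cancel₀ _ hb.ne']
    have hode := gegenbauerSeries_ode (l := l) hm (habs y hy')
    have hw : 0 < (y * (1 - ε * y)) ^ (m - 1) * (l * gegenbauerSeries m l ε y) :=
      mul_pos (Real.rpow_pos_of_pos hb _) (mul_pos hl (hpos y hy))
    rw [hbm]
    linear_combination hw + (y * (1 - ε * y)) ^ (m - 1) * hode
  have h := hanti (Set.left_mem_Icc.2 hy₀.le) (Set.right_mem_Icc.2 hy₀.le) hy₀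
  have hb : 0 < (y₀ * (1 - ε * y₀)) ^ m := Real.rpow_pos_of_pos (mul_pos hy₀ (by linarith)) _
  simp only [zero_mul, Real.zero_rpow (by linarith : m ≠ 0)] at h
  exact neg_of_mul_neg_right h hb.le

/-- A continuous function which is positive at `0` and nonpositive at `R` has a first zero. -/
theorem exists_first_zero {f : ℝ → ℝ} {R : ℝ} (hR : 0 ≤ R) (hf : ContinuousOn f (Set.Icc 0 R))
    (h0 : 0 < f 0) (hfR : f R ≤ 0) :
    ∃ y₀ ∈ Set.Ioc 0 R, f y₀ = 0 ∧ ∀ y ∈ Set.Ico 0 y₀, 0 < f y := by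
  have hcl : IsClosed (Set.Icc 0 R ∩ f ⁻¹' Set.Iic 0) := hf.preimage_isClosed_of_isClosed
    isClosed_Icc isClosed_Iic
  have hbd : BddBelow (Set.Icc 0 R ∩ f ⁻¹' Set.Iic 0) := ⟨0, fun y hy => hy.1.1⟩
  have hmem := hcl.csInf_mem ⟨R, Set.right_mem_Icc.2 hR, hfR⟩ hbd
  set y₀ := sInf (Set.Icc 0 R ∩ f ⁻¹' Set.Iic 0)
  have hpos : ∀ y ∈ Set.Ico 0 y₀, 0 < f y := fun y hy => by
    by_contra hn
    exact (notMem_of_lt_csInf hy.2 hbd) ⟨⟨hy.1, hy.2.le.trans hmem.1.2⟩, not_lt.1 hn⟩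
  have hy₀ : 0 < y₀ := lt_of_le_of_ne hmem.1.1 fun h => by
    have := hmem.2
    rw [← h] at this
    exact absurd h0 (not_lt.2 this)
  refine ⟨y₀, ⟨hy₀, hmem.1.2⟩, le_antisymm hmem.2 ?_, hpos⟩
  have hc : ContinuousWithinAt f (Set.Ico 0 y₀) y₀ :=
    (hf y₀ hmem.1).mono fun y hy => ⟨hy.1, hy.2.le.trans hmem.1.2⟩
  have : (𝓝[Set.Ico 0 y₀] y₀).NeBot := by
    rw [← mem_closure_iff_nhdsWithin_neBot, closure_Ico hy₀.ne]
    exact Set.right_mem_Icc.2 hy₀.le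
  exact ge_of_tendsto hc (eventually_nhdsWithin_of_forall fun y hy => (hpos y hy).le)

theorem continuousOn_gegenbauerSeries {m l ε R : ℝ} (hm : 1 ≤ m) (hε : 0 ≤ ε) (hR : ε * R < 1) :
    ContinuousOn (gegenbauerSeries m l ε) (Set.Icc 0 R) := fun y hy =>
  (hasDerivAt_gegenbauerSeries hm (by
    rw [abs_of_nonneg (mul_nonneg hε hy.1)]
    exact (mul_le_mul_of_nonneg_left hy.2 hε).trans_lt hR)).continuousAt.continuousWithinAt

/-- Just to the right of a first zero, the series is negative. -/
theorem exists_gegenbauerSeries_neg {m l ε y₀ z : ℝ} (hm : 1 ≤ m) (hl : 0 < l) (hε : 0 ≤ ε)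
    (hy₀ : 0 < y₀) (hεy : ε * y₀ < 1) (hz : gegenbauerSeries m l ε y₀ = 0)
    (hpos : ∀ y ∈ Set.Ico 0 y₀, 0 < gegenbauerSeries m l ε y) (hyz : y₀ < z) :
    ∃ y ∈ Set.Ioo y₀ z, gegenbauerSeries m l ε y < 0 := by
  have hd := gegenbauerSeries_deriv_neg hm hl hε hy₀ hεy fun y hy => hpos y ⟨hy.1.le, hy.2⟩
  have h := (hasDerivAt_gegenbauerSeries (l := l) (y := y₀) hm (by
    rwa [abs_of_nonneg (mul_nonneg hε hy₀.le)])).tendsto_slope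
  have h1 : ∀ᶠ y in 𝓝[>] y₀, slope (gegenbauerSeries m l ε) y₀ y < 0 :=
    (h.mono_left (nhdsWithin_mono _ fun y hy => ne_of_gt hy)).eventually_lt_const hd
  obtain ⟨y, hy, hyI⟩ := (h1.and (Ioo_mem_nhdsGT hyz)).exists
  refine ⟨y, hyI, ?_⟩
  rw [slope_def_field, hz, sub_zero] at hy
  exact (div_neg_iff.1 hy).resolve_left (fun h => by linarith [h.2, hyI.1]) |>.1

/-- The normalized Bessel function `gegenbauerSeries m 1 0` takes a nonpositive value. -/
theorem exists_gegenbauerSeries_nonpos {m : ℝ} (hm : 1 ≤ m) :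
    ∃ y, 0 < y ∧ gegenbauerSeries m 1 0 y ≤ 0 := by
  by_contra! hpos
  have hm0 : 0 < m := by linarith
  have habs : ∀ y : ℝ, |0 * y| < 1 := fun y => by simp
  have hneg : ∀ y, 0 < y → gegenbauerDeriv m 1 0 y < 0 := fun y hy =>
    gegenbauerSeries_deriv_neg hm one_pos le_rfl hy (by simp) fun z hz => hpos z hz.1
  have hode : ∀ y, y * gegenbauerDeriv₂ m 1 0 y + m * gegenbauerDeriv m 1 0 y
      + gegenbauerSeries m 1 0 y = 0 := fun y => by
    simpa using gegenbauerSeries_ode (l := 1) hm (habs y)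
  -- By the equation, the derivative of `y ^ m (m f' + f)` is `y ^ m f' ≤ 0`, and the function
  -- vanishes at `0`.
  have hle : ∀ y, 0 < y → gegenbauerSeries m 1 0 y ≤ -m * gegenbauerDeriv m 1 0 y := by
    intro y₀ hy₀
    have hd : ∀ y, HasDerivAt
        (fun y => y ^ m * (m * gegenbauerDeriv m 1 0 y + gegenbauerSeries m 1 0 y))
        (1 * m * y ^ (m - 1) * (m * gegenbauerDeriv m 1 0 y + gegenbauerSeries m 1 0 y) +
          y ^ m * (m * gegenbauerDeriv₂ m 1 0 y + gegenbauerDeriv m 1 0 y)) y := fun y =>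
      ((hasDerivAt_id y).rpow_const (Or.inr hm)).mul
        (((hasDerivAt_gegenbauerDeriv hm (habs y)).const_mul m).add
          (hasDerivAt_gegenbauerSeries hm (habs y)))
    have hanti : AntitoneOn
        (fun y => y ^ m * (m * gegenbauerDeriv m 1 0 y + gegenbauerSeries m 1 0 y))
        (Set.Icc 0 y₀) := by
      refine antitoneOn_of_deriv_nonpos (convex_Icc _ _)
        (fun y _ => (hd y).continuousAt.continuousWithinAt)
        (fun y _ => (hd y).differentiableAt.differentiableWithinAt) fun y hy => ?_
      rw [interior_Icc] at hy
      rw [(hd y).deriv]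
      have hbm : y ^ m = y ^ (m - 1) * y := by
        rw [Real.rpow_sub_one hy.1.ne', div_mul_cancel₀ _ hy.1.ne']
      have hw : y ^ (m - 1) * y * gegenbauerDeriv m 1 0 y ≤ 0 :=
        mul_nonpos_of_nonneg_of_nonpos
          (mul_pos (Real.rpow_pos_of_pos hy.1 _) hy.1).le (hneg y hy.1).le
      rw [hbm]
      linear_combination hw + m * y ^ (m - 1) * hode y
    have h := hanti (Set.left_mem_Icc.2 hy₀.le) (Set.right_mem_Icc.2 hy₀.le) hy₀.le
    simp only [Real.zero_rpow hm0.ne', zero_mul] at h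
    have := nonpos_of_mul_nonpos_right h (Real.rpow_pos_of_pos hy₀ m)
    linarith
  -- Riccati argument: `w = -f / f'` is positive with `w' = -1 + f f'' / f' ^ 2`. For `y ≥ 2 m ^ 2`
  -- the equation and `f ≤ -m f'` give `f f'' ≤ f' ^ 2 / 2`, so `w' ≤ -1 / 2` and `w` cannot stay
  -- positive.
  have hd : ∀ y, 0 < y → HasDerivAt
      (fun y => -gegenbauerSeries m 1 0 y / gegenbauerDeriv m 1 0 y + 2⁻¹ * y)
      ((-gegenbauerDeriv m 1 0 y * gegenbauerDeriv m 1 0 y -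
        -gegenbauerSeries m 1 0 y * gegenbauerDeriv₂ m 1 0 y) / gegenbauerDeriv m 1 0 y ^ 2 +
        2⁻¹ * 1) y := fun y hy =>
    ((hasDerivAt_gegenbauerSeries hm (habs y)).neg.div
      (hasDerivAt_gegenbauerDeriv hm (habs y)) (hneg y hy).ne).add
      ((hasDerivAt_id y).const_mul _)
  have h2m : 0 < 2 * m ^ 2 := by positivity
  have hanti : AntitoneOn
      (fun y => -gegenbauerSeries m 1 0 y / gegenbauerDeriv m 1 0 y + 2⁻¹ * y)
      (Set.Ici (2 * m ^ 2)) := by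
    refine antitoneOn_of_deriv_nonpos (convex_Ici _)
      (fun y hy => (hd y (h2m.trans_le hy)).continuousAt.continuousWithinAt)
      (fun y hy => ?_) fun y hy => ?_
    · exact (hd y (h2m.trans_le (interior_subset hy))).differentiableAt.differentiableWithinAt
    · have hy : 2 * m ^ 2 ≤ y := interior_subset hy
      have hy0 := h2m.trans_le hy
      rw [(hd y hy0).deriv]
      have hF := hpos y hy0
      have hD := hneg y hy0
      have hL := hle y hy0
      have hO := hode y
      set F := gegenbauerSeries m 1 0 y
      set D := gegenbauerDeriv m 1 0 y
      set D₂ := gegenbauerDeriv₂ m 1 0 y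
      suffices h : F * D₂ ≤ 2⁻¹ * D ^ 2 by
        have hD2 : 0 < D ^ 2 := sq_pos_of_neg hD
        rw [div_add' _ _ _ hD2.ne']
        refine div_nonpos_of_nonpos_of_nonneg ?_ hD2.le
        linarith
      have h1 : y * (F * D₂) ≤ F * (-m * D) := by
        have : y * (F * D₂) = F * (-m * D) - F ^ 2 := by linear_combination F * hO
        nlinarith
      have h2 : F * (-m * D) ≤ (-m * D) * (-m * D) :=
        mul_le_mul_of_nonneg_right hL (by nlinarith)
      have h3 : 2 * m ^ 2 * D ^ 2 ≤ y * D ^ 2 := mul_le_mul_of_nonneg_right hy (sq_nonneg _)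
      refine le_of_mul_le_mul_left ?_ hy0
      linarith
  have hq : ∀ y, 0 < y → 0 < -gegenbauerSeries m 1 0 y / gegenbauerDeriv m 1 0 y := fun y hy =>
    div_pos_of_neg_of_neg (neg_neg_of_pos (hpos y hy)) (hneg y hy)
  set C := -gegenbauerSeries m 1 0 (2 * m ^ 2) / gegenbauerDeriv m 1 0 (2 * m ^ 2) +
    2⁻¹ * (2 * m ^ 2) with hC
  -- At `y = 2 C` the term `y / 2` already equals the initial value `C`, which forces `w ≤ 0`.
  have hCpos : 2 * m ^ 2 ≤ 2 * C := by linarith [hq _ h2m]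
  have := hanti Set.self_mem_Ici hCpos hCpos
  simp only at this
  linarith [hq (2 * C) (h2m.trans_le hCpos)]

theorem exists_first_zero_gegenbauerSeries {m : ℝ} (hm : 1 ≤ m) :
    ∃ y₀, 0 < y₀ ∧ gegenbauerSeries m 1 0 y₀ = 0 ∧
      ∀ y ∈ Set.Ico 0 y₀, 0 < gegenbauerSeries m 1 0 y := by
  obtain ⟨R, hR, h⟩ := exists_gegenbauerSeries_nonpos hm
  obtain ⟨y₀, hy₀, h0, hp⟩ := exists_first_zero hR.le
    (continuousOn_gegenbauerSeries hm le_rfl (by simp)) (by simp [gegenbauerSeries_zero]) h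
  exact ⟨y₀, hy₀.1, h0, hp⟩

/-! ### Identification of the limit series with the Bessel function. -/

theorem Gamma_add_natCast_mul_gegenbauerCoeff {m : ℝ} (hm : 1 ≤ m) (k : ℕ) :
    k.factorial * Real.Gamma (k + m) * gegenbauerCoeff m 1 0 k = (-1) ^ k * Real.Gamma m := by
  induction k with
  | zero => simp [gegenbauerCoeff]
  | succ k ih =>
    have h := natCast_add_one_mul_add_pos hm k
    have hk : (k : ℝ) + m ≠ 0 := (pos_of_mul_pos_right h (by positivity)).ne'
    rw [gegenbauerCoeff, pow_succ, Nat.factorial_succ]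
    push_cast
    rw [add_right_comm, Real.Gamma_add_one hk]
    field_simp
    linear_combination -ih

theorem besselJ_eq {m x : ℝ} (hm : 1 ≤ m) :
    besselJ (m - 1) x =
      (x / 2) ^ (m - 1) * ((Real.Gamma m)⁻¹ * gegenbauerSeries m 1 0 (x ^ 2 / 4)) := by
  rw [besselJ, gegenbauerSeries, ← tsum_mul_left (a := (Real.Gamma m)⁻¹)]
  refine congrArg _ (tsum_congr fun k => ?_)
  have h := Gamma_add_natCast_mul_gegenbauerCoeff hm k
  have h1 : (k.factorial : ℝ) ≠ 0 := by positivity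
  have h2 : Real.Gamma (k + m) ≠ 0 := (Real.Gamma_pos_of_pos (by positivity)).ne'
  have h3 : Real.Gamma m ≠ 0 := (Real.Gamma_pos_of_pos (by positivity)).ne'
  have e1 : (k : ℝ) + (m - 1) + 1 = k + m := by ring
  have e2 : x ^ 2 / 4 = (x / 2) ^ 2 := by ring
  rw [e1, e2, ← pow_mul]
  field_simp
  linear_combination -((x / 2) ^ (2 * k)) * h

/-- The first positive zero of `J_{m-1}`, in terms of the first zero of the normalized series. -/
theorem isLeast_besselJ_zero {m : ℝ} (hm : 1 ≤ m) :
    ∃ B, 0 < B ∧ IsLeast {x : ℝ | 0 < x ∧ besselJ (m - 1) x = 0} B ∧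
      gegenbauerSeries m 1 0 (B ^ 2 / 4) = 0 ∧
      ∀ y ∈ Set.Ico 0 (B ^ 2 / 4), 0 < gegenbauerSeries m 1 0 y := by
  obtain ⟨y₀, hy₀, h0, hp⟩ := exists_first_zero_gegenbauerSeries hm
  have hB : (2 * √y₀) ^ 2 / 4 = y₀ := by rw [mul_pow, Real.sq_sqrt hy₀.le]; ring
  have hB0 : 0 < 2 * √y₀ := by positivity
  refine ⟨2 * √y₀, hB0, ⟨⟨hB0, ?_⟩, fun x hx => ?_⟩, by rwa [hB], by rwa [hB]⟩
  · rw [besselJ_eq hm, hB, h0, mul_zero, mul_zero]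
  · obtain ⟨hx0, hx⟩ := hx
    by_contra! hlt
    have hx2 : x ^ 2 / 4 < y₀ := by
      rw [← hB]; gcongr
    have := hp _ ⟨by positivity, hx2⟩
    have hG : 0 < Real.Gamma m := Real.Gamma_pos_of_pos (by linarith)
    rw [besselJ_eq hm] at hx
    exact absurd hx (by positivity)

/-! ### Second-derivative tests and the spherical Laplacian of zonal functions. -/

theorem iteratedFDeriv_two_eq_deriv_deriv {E : Type*} [NormedAddCommGroup E] [NormedSpace ℝ E]
    {f : E → ℝ} {x : E} (hf : ContDiffAt ℝ 2 f x) (v : E) :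
    iteratedFDeriv ℝ 2 f x ![v, v] = deriv (deriv fun τ : ℝ => f (x + τ • v)) 0 := by
  have hline : ∀ τ : ℝ, HasDerivAt (fun τ : ℝ => x + τ • v) v τ := fun τ => by
    simpa using ((hasDerivAt_id τ).smul_const v).const_add x
  have hx : x + (0 : ℝ) • v = x := by simp
  have hd : ∀ᶠ z in 𝓝 x, DifferentiableAt ℝ f z :=
    (hf.eventually (by simp)).mono fun z hz => hz.differentiableAt (by norm_num)
  have ht : Tendsto (fun τ : ℝ => x + τ • v) (𝓝 0) (𝓝 x) := by
    simpa [hx] using (hline 0).continuousAt.tendsto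
  have h1 : (deriv fun τ : ℝ => f (x + τ • v)) =ᶠ[𝓝 0] fun τ => fderiv ℝ f (x + τ • v) v := by
    filter_upwards [ht.eventually hd] with τ hτ
    exact (hτ.hasFDerivAt.comp_hasDerivAt τ (hline τ)).deriv
  rw [h1.deriv_eq, iteratedFDeriv_two_apply]
  have h2 : DifferentiableAt ℝ (fderiv ℝ f) (x + (0 : ℝ) • v) := by
    rw [hx]
    exact (hf.fderiv_right (m := 1) (by norm_num)).differentiableAt (by norm_num)
  have h3 : HasDerivAt (fun τ : ℝ => fderiv ℝ f (x + τ • v))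
      (fderiv ℝ (fderiv ℝ f) (x + (0 : ℝ) • v) v) 0 :=
    h2.hasFDerivAt.comp_hasDerivAt (0 : ℝ) (hline 0)
  have h4 : HasDerivAt (fun τ : ℝ => fderiv ℝ f (x + τ • v) v)
      (fderiv ℝ (fderiv ℝ f) (x + (0 : ℝ) • v) v v) 0 :=
    (ContinuousLinearMap.apply ℝ ℝ v).hasFDerivAt.comp_hasDerivAt (0 : ℝ) h3
  rw [h4.deriv, hx]
  rfl

theorem deriv_deriv_nonpos_of_isLocalMax {f : ℝ → ℝ} {x : ℝ} (h : IsLocalMax f x)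
    (hc : ContinuousAt f x) : deriv (deriv f) x ≤ 0 := by
  by_contra! hpos
  -- A positive second derivative would make the maximum a minimum too, so `f` would be locally
  -- constant.
  have hmin := isLocalMin_of_deriv_deriv_pos hpos h.deriv_eq_zero hc
  have hconst : f =ᶠ[𝓝 x] fun _ => f x := by
    filter_upwards [h, hmin] with y h1 h2 using le_antisymm h1 h2
  rw [hconst.deriv.deriv_eq] at hpos
  simp at hpos

theorem laplacian_nonpos_of_isLocalMax {E : Type*} [NormedAddCommGroup E] [InnerProductSpace ℝ E]
    [FiniteDimensional ℝ E] {f : E → ℝ} {x : E} (hf : ContDiffAt ℝ 2 f x) (h : IsLocalMax f x) :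
    Laplacian.laplacian f x ≤ 0 := by
  rw [InnerProductSpace.laplacian_eq_iteratedFDeriv_stdOrthonormalBasis]
  refine Finset.sum_nonpos fun i _ => ?_
  rw [iteratedFDeriv_two_eq_deriv_deriv hf]
  have hc : ContinuousAt (fun τ : ℝ => x + τ • stdOrthonormalBasis ℝ E i) 0 := by fun_prop
  have hx : x + (0 : ℝ) • stdOrthonormalBasis ℝ E i = x := by simp
  refine deriv_deriv_nonpos_of_isLocalMax ?_ ?_
  · have := hc.tendsto
    rw [hx] at this
    have h' := this.eventually h
    simpa [IsLocalMax, IsMaxFilter] using h'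
  · exact ContinuousAt.comp (g := f) (by rw [hx]; exact hf.continuousAt) hc

theorem deriv_deriv_comp_eq {g q : ℝ → ℝ} (hg : ContDiffAt ℝ 2 g (q 0)) (hq : ContDiffAt ℝ 2 q 0) :
    deriv (deriv fun τ => g (q τ)) 0 =
      deriv (deriv g) (q 0) * deriv q 0 ^ 2 + deriv g (q 0) * deriv (deriv q) 0 := by
  have hg1 : ∀ᶠ z in 𝓝 (q 0), DifferentiableAt ℝ g z :=
    (hg.eventually (by simp)).mono fun z hz => hz.differentiableAt (by norm_num)
  have hq1 : ∀ᶠ z in 𝓝 0, DifferentiableAt ℝ q z :=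
    (hq.eventually (by simp)).mono fun z hz => hz.differentiableAt (by norm_num)
  have h1 : (deriv fun τ => g (q τ)) =ᶠ[𝓝 0] fun τ => deriv g (q τ) * deriv q τ := by
    filter_upwards [hq.continuousAt.eventually hg1, hq1] with τ h1 h2
    exact (h1.hasDerivAt.comp τ h2.hasDerivAt).deriv
  have hg2 : DifferentiableAt ℝ (deriv g) (q 0) :=
    (hg.derivWithin (m := 1) (by norm_num)).differentiableAt (by norm_num)
  have hq2 : DifferentiableAt ℝ (deriv q) 0 :=
    (hq.derivWithin (m := 1) (by norm_num)).differentiableAt (by norm_num)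
  rw [h1.deriv_eq]
  have h2 := (hg2.hasDerivAt.comp (0 : ℝ) hq1.self_of_nhds.hasDerivAt).mul hq2.hasDerivAt
  have h3 := h2.deriv
  simp only [Function.comp_def, Pi.mul_def] at h3
  rw [h3]; ring

theorem contDiffAt_inner_normalize {E : Type*} [NormedAddCommGroup E] [InnerProductSpace ℝ E]
    (e : E) {x : E} (hx : x ≠ 0) :
    ContDiffAt ℝ 2 (fun x : E => inner ℝ (‖x‖⁻¹ • x) e) x :=
  (((contDiffAt_norm ℝ hx).inv (norm_ne_zero_iff.2 hx)).smul contDiffAt_id).inner ℝ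
    contDiffAt_const

theorem hasDerivAt_sqrt_quadratic (a : ℝ) {τ : ℝ} (h : 0 < 1 + 2 * a * τ + τ ^ 2) :
    HasDerivAt (fun τ : ℝ => √(1 + 2 * a * τ + τ ^ 2)) ((a + τ) / √(1 + 2 * a * τ + τ ^ 2)) τ := by
  have h1 : HasDerivAt (fun τ : ℝ => 1 + 2 * a * τ + τ ^ 2) (2 * a * 1 + 2 * τ) τ :=
    ((((hasDerivAt_id τ).const_mul (2 * a)).const_add 1).add (hasDerivAt_pow 2 τ)).congr_deriv
      (by simp)
  refine (h1.sqrt h.ne').congr_deriv ?_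
  rw [← mul_div_mul_left (a + τ) _ two_ne_zero]
  ring

/-- Along the line the normalized height is explicitly `(t + τ b) / √(1 + 2 a τ + τ ^ 2)`, with `a =
⟪ω, v⟫`, `b = ⟪v, e⟫`, `t = ⟪ω, e⟫`. -/
theorem deriv_inner_normalize_line {E : Type*} [NormedAddCommGroup E] [InnerProductSpace ℝ E]
    {e ω v : E} (hω : ‖ω‖ = 1) (hv : ‖v‖ = 1) :
    deriv (fun τ : ℝ => inner ℝ (‖ω + τ • v‖⁻¹ • (ω + τ • v)) e) 0 =
        inner ℝ v e - inner ℝ ω e * inner ℝ ω v ∧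
      deriv (deriv fun τ : ℝ => inner ℝ (‖ω + τ • v‖⁻¹ • (ω + τ • v)) e) 0 =
        inner ℝ ω e * (3 * inner ℝ ω v ^ 2 - 1) - 2 * inner ℝ ω v * inner ℝ v e := by
  set a : ℝ := inner ℝ ω v with ha
  set b : ℝ := inner ℝ v e
  set t : ℝ := inner ℝ ω e
  set n : ℝ → ℝ := fun τ => √(1 + 2 * a * τ + τ ^ 2) with hn
  have hq : (fun τ : ℝ => inner ℝ (‖ω + τ • v‖⁻¹ • (ω + τ • v)) e) = fun τ => (t + τ * b) / n τ := by
    funext τ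
    have : ‖ω + τ • v‖ = n τ := by
      rw [hn, ← Real.sqrt_sq (norm_nonneg (ω + τ • v)), norm_add_sq_real, hω, norm_smul, hv,
        inner_smul_right, ← ha]
      congr 1
      rw [mul_one, Real.norm_eq_abs, sq_abs]
      ring
    rw [this, inner_smul_left, inner_add_left, inner_smul_left]
    simp only [conj_trivial]
    ring
  have hev : ∀ᶠ τ : ℝ in 𝓝 0, 0 < 1 + 2 * a * τ + τ ^ 2 :=
    (isOpen_lt (by fun_prop) (by fun_prop) : IsOpen {τ : ℝ | 0 < 1 + 2 * a * τ + τ ^ 2}).mem_nhds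
      (by simp)
  have hl : ∀ τ, HasDerivAt (fun τ => t + τ * b) b τ := fun τ => by
    simpa using ((hasDerivAt_id τ).mul_const b).const_add t
  have h1 : ∀ τ : ℝ, 0 < 1 + 2 * a * τ + τ ^ 2 → HasDerivAt (fun τ => (t + τ * b) / n τ)
      (b / n τ - (t + τ * b) * (a + τ) / n τ ^ 3) τ := fun τ hτ => by
    have hnτ : n τ ≠ 0 := (Real.sqrt_pos.2 hτ).ne'
    refine ((hl τ).div (hasDerivAt_sqrt_quadratic a hτ) hnτ).congr_deriv ?_
    change (b * n τ - (t + τ * b) * ((a + τ) / n τ)) / n τ ^ 2 = _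
    field_simp
  have hn0 : n 0 = 1 := by simp [hn]
  have h0 := hev.self_of_nhds
  rw [hq]
  refine ⟨?_, ?_⟩
  · rw [(h1 0 h0).deriv, hn0]; ring
  · have hd : deriv (fun τ => (t + τ * b) / n τ) =ᶠ[𝓝 0]
        fun τ => b / n τ - (t + τ * b) * (a + τ) / n τ ^ 3 := by
      filter_upwards [hev] with τ hτ using (h1 τ hτ).deriv
    rw [hd.deriv_eq]
    have hdn : HasDerivAt n a 0 := by
      have := hasDerivAt_sqrt_quadratic a h0
      simpa [hn] using this
    have ha' : HasDerivAt (fun τ : ℝ => a + τ) 1 0 := (hasDerivAt_id (0 : ℝ)).const_add a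
    have h2 := (((hasDerivAt_const (0 : ℝ) b).div hdn (by rw [hn0]; exact one_ne_zero)).sub
      (((hl 0).mul ha').div (hdn.pow 3) (by rw [Pi.pow_apply, hn0]; simp)))
    refine h2.deriv.trans ?_
    simp only [Pi.mul_apply, Pi.pow_apply, hn0]
    norm_num
    ring

/-- The spherical Laplacian of a function which depends only on the height `⟪x, e⟫`. -/
theorem sphericalLaplacian_zonal {N : ℕ} {e ω : EuclideanSpace ℝ (Fin N)} (he : ‖e‖ = 1)
    (hω : ‖ω‖ = 1) {g : ℝ → ℝ} (hg : ContDiffAt ℝ 2 g (inner ℝ ω e)) :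
    sphericalLaplacian (fun x => g (inner ℝ x e)) ω =
      (1 - inner ℝ ω e ^ 2) * deriv (deriv g) (inner ℝ ω e)
        - (N - 1) * inner ℝ ω e * deriv g (inner ℝ ω e) := by
  have hω0 : ω ≠ 0 := norm_ne_zero_iff.1 (by rw [hω]; exact one_ne_zero)
  have hnorm : inner ℝ (‖ω‖⁻¹ • ω) e = inner ℝ ω e := by rw [hω, inv_one, one_smul]
  have hcd : ContDiffAt ℝ 2 (homogeneousExtension fun x => g (inner ℝ x e)) ω :=
    ContDiffAt.comp ω (g := g) (by rwa [hnorm]) (contDiffAt_inner_normalize e hω0)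
  let v := EuclideanSpace.basisFun (Fin N) ℝ
  have hterm : ∀ i, iteratedFDeriv ℝ 2 (homogeneousExtension fun x => g (inner ℝ x e)) ω
      ![v i, v i] = deriv (deriv g) (inner ℝ ω e) *
        (inner ℝ (v i) e - inner ℝ ω e * inner ℝ ω (v i)) ^ 2 + deriv g (inner ℝ ω e) *
        (inner ℝ ω e * (3 * inner ℝ ω (v i) ^ 2 - 1) - 2 * inner ℝ ω (v i) * inner ℝ (v i) e) := by
    intro i
    obtain ⟨h1, h2⟩ := deriv_inner_normalize_line (e := e) hω (v.norm_eq_one i)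
    rw [iteratedFDeriv_two_eq_deriv_deriv hcd, ← h1, ← h2]
    have hz : inner ℝ (‖ω + (0 : ℝ) • v i‖⁻¹ • (ω + (0 : ℝ) • v i)) e = inner ℝ ω e := by
      rw [zero_smul, add_zero, hnorm]
    have hq : ContDiffAt ℝ 2
        (fun τ : ℝ => inner ℝ (‖ω + τ • v i‖⁻¹ • (ω + τ • v i)) e) 0 :=
      ContDiffAt.comp (0 : ℝ) (g := fun x => inner ℝ (‖x‖⁻¹ • x) e)
        (f := fun τ : ℝ => ω + τ • v i)
        (by simpa using contDiffAt_inner_normalize e hω0) (by fun_prop)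
    have := deriv_deriv_comp_eq (g := g) (by rwa [hz]) hq
    rw [hz] at this
    exact this
  -- Parseval's identities collapse the sum over the basis to an expression in `⟪ω, e⟫` and `N`.
  have s1 : ∑ i, inner ℝ ω (v i) ^ 2 = (1 : ℝ) := by
    have := v.sum_inner_mul_inner ω ω
    rw [real_inner_self_eq_norm_sq, hω] at this
    simpa [real_inner_comm ω, sq] using this
  have s2 : ∑ i, inner ℝ (v i) e ^ 2 = (1 : ℝ) := by
    have := v.sum_inner_mul_inner e e
    rw [real_inner_self_eq_norm_sq, he] at this
    simpa [real_inner_comm e, sq] using this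
  have s3 := v.sum_inner_mul_inner ω e
  unfold sphericalLaplacian
  rw [InnerProductSpace.laplacian_eq_iteratedFDeriv_orthonormalBasis _ v]
  simp only [hterm]
  set t : ℝ := inner ℝ ω e
  set A := deriv (deriv g) t
  set B := deriv g t
  have hsplit : ∀ i, A * (inner ℝ (v i) e - t * inner ℝ ω (v i)) ^ 2 +
      B * (t * (3 * inner ℝ ω (v i) ^ 2 - 1) - 2 * inner ℝ ω (v i) * inner ℝ (v i) e) =
      A * inner ℝ (v i) e ^ 2 + (A * t ^ 2 + 3 * B * t) * inner ℝ ω (v i) ^ 2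
        - (2 * A * t + 2 * B) * (inner ℝ ω (v i) * inner ℝ (v i) e) - B * t := fun i => by ring
  simp only [hsplit, Finset.sum_sub_distrib, Finset.sum_add_distrib, ← Finset.mul_sum, s1, s2, s3,
    Finset.sum_const, Finset.card_univ, Fintype.card_fin, nsmul_eq_mul]
  ring

/-! ### Geometry of the cap. -/

theorem norm_northPole {N : ℕ} (hN : 1 ≤ N) : ‖northPole N‖ = 1 := by
  have h : northPole N = EuclideanSpace.single (⟨N - 1, by omega⟩ : Fin N) (1 : ℝ) := by
    ext i
    simp only [northPole, PiLp.single_apply, Fin.ext_iff]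
    congr 1
    exact propext (by omega)
  rw [h, PiLp.norm_single, norm_one]

theorem mem_sphericalCap_iff {N : ℕ} (hN : 1 ≤ N) {γ : ℝ} (h0 : 0 < γ) (hπ : γ < Real.pi)
    {x : EuclideanSpace ℝ (Fin N)} :
    x ∈ sphericalCap N γ ↔ ‖x‖ = 1 ∧ Real.cos γ < inner ℝ x (northPole N) := by
  rw [sphericalCap, Set.mem_inter_iff, mem_sphere_zero_iff_norm, and_comm]
  refine and_congr_right fun hx => ?_
  have hx0 : x ≠ 0 := norm_ne_zero_iff.1 (by rw [hx]; exact one_ne_zero)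
  have hc : inner ℝ x (northPole N) = Real.cos (InnerProductGeometry.angle x (northPole N)) := by
    rw [InnerProductGeometry.cos_angle, hx, norm_northPole hN, mul_one, div_one]
  rw [hc, Real.strictAntiOn_cos.lt_iff_gt ⟨h0.le, hπ.le⟩
    ⟨InnerProductGeometry.angle_nonneg _ _, InnerProductGeometry.angle_le_pi _ _⟩]
  exact and_iff_right hx0

/-- This inclusion suffices: it puts every boundary point at height exactly `cos γ`. -/
theorem closure_sphericalCap_subset {N : ℕ} (hN : 1 ≤ N) {γ : ℝ} (h0 : 0 < γ)
    (hπ : γ < Real.pi) : closure (sphericalCap N γ) ⊆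
      {x | ‖x‖ = 1 ∧ Real.cos γ ≤ inner ℝ x (northPole N)} := by
  refine closure_minimal (fun x hx => ?_) ?_
  · obtain ⟨h1, h2⟩ := (mem_sphericalCap_iff hN h0 hπ).1 hx
    exact ⟨h1, h2.le⟩
  · have h : Continuous fun x : EuclideanSpace ℝ (Fin N) => inner ℝ x (northPole N) :=
      continuous_id.inner continuous_const
    exact (isClosed_eq continuous_norm continuous_const).and (isClosed_le continuous_const h)

theorem isCompact_closure_sphericalCap (N : ℕ) (γ : ℝ) :
    IsCompact (closure (sphericalCap N γ)) :=
  (isCompact_sphere (0 : EuclideanSpace ℝ (Fin N)) 1).closure_of_subset Set.inter_subset_right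

theorem isOpen_setOf_normalize_mem_sphericalCap {N : ℕ} (hN : 1 ≤ N) {γ : ℝ} (h0 : 0 < γ)
    (hπ : γ < Real.pi) :
    IsOpen {x : EuclideanSpace ℝ (Fin N) | x ≠ 0 ∧ ‖x‖⁻¹ • x ∈ sphericalCap N γ} := by
  have hc : ContinuousOn (fun x : EuclideanSpace ℝ (Fin N) =>
      inner ℝ (‖x‖⁻¹ • x) (northPole N)) {x | x ≠ 0} := fun x hx =>
    (contDiffAt_inner_normalize _ hx).continuousAt.continuousWithinAt
  convert hc.isOpen_inter_preimage isOpen_ne (isOpen_Ioi (a := Real.cos γ)) using 1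
  ext x
  refine and_congr_right fun hx => ?_
  rw [mem_sphericalCap_iff hN h0 hπ, norm_smul, norm_inv, norm_norm,
    inv_mul_cancel₀ (norm_ne_zero_iff.2 hx)]
  exact and_iff_right rfl

theorem homogeneousExtension_apply_of_norm_eq_one {N : ℕ} (u : EuclideanSpace ℝ (Fin N) → ℝ)
    {x : EuclideanSpace ℝ (Fin N)} (hx : ‖x‖ = 1) : homogeneousExtension u x = u x := by
  rw [homogeneousExtension, hx, inv_one, one_smul]

theorem northPole_mem_sphericalCap {N : ℕ} (hN : 1 ≤ N) {γ : ℝ} (h0 : 0 < γ)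
    (hπ : γ < Real.pi) : northPole N ∈ sphericalCap N γ := by
  refine (mem_sphericalCap_iff hN h0 hπ).2 ⟨norm_northPole hN, ?_⟩
  rw [real_inner_self_eq_norm_sq, norm_northPole hN, one_pow, ← Real.cos_zero]
  exact Real.strictAntiOn_cos ⟨le_rfl, Real.pi_pos.le⟩ ⟨h0.le, hπ.le⟩ h0

/-! ### Zonal solutions on the cap. -/

/-- The zonal function on the sphere given by the series in `(1 - x_N) / 2`. -/
noncomputable def zonalSeries (N : ℕ) (l : ℝ) (x : EuclideanSpace ℝ (Fin N)) : ℝ :=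
  gegenbauerSeries (((N : ℝ) - 1) / 2) l 1 ((1 - inner ℝ x (northPole N)) / 2)

theorem one_le_half_natCast_sub_one {N : ℕ} (hN : 3 ≤ N) : (1 : ℝ) ≤ ((N : ℝ) - 1) / 2 := by
  have : (3 : ℝ) ≤ N := by exact_mod_cast hN
  linarith

theorem contDiffAt_gegenbauerSeries_comp {m : ℝ} (hm : 1 ≤ m) (l : ℝ) {t : ℝ} (ht : -1 < t)
    (ht' : t ≤ 1) :
    ContDiffAt ℝ 2 (fun t => gegenbauerSeries m l 1 ((1 - t) / 2)) t := by
  refine ContDiffAt.comp t (g := gegenbauerSeries m l 1) ?_ (by fun_prop)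
  refine (contDiffOn_gegenbauerSeries 2 hm l 1).contDiffAt ((isOpen_abs_mul_lt_one 1).mem_nhds ?_)
  rw [Set.mem_ofPred_eq, abs_lt]
  constructor <;> linarith

theorem inner_northPole_le_one {N : ℕ} (hN : 1 ≤ N) {x : EuclideanSpace ℝ (Fin N)}
    (hx : ‖x‖ = 1) : inner ℝ x (northPole N) ≤ 1 := by
  simpa [hx, norm_northPole hN] using real_inner_le_norm x (northPole N)

/-- With `t = 1 - 2 s` one has `1 - t ^ 2 = 4 s (1 - s)` and `d/dt = -(1/2) d/ds`, so the zonal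
operator becomes that of `gegenbauerSeries_ode` with `ε = 1`. The condition `-1 < t` keeps `s`
inside the unit disc of convergence. -/
theorem sphericalLaplacian_zonalSeries {N : ℕ} (hN : 3 ≤ N) (l : ℝ)
    {ω : EuclideanSpace ℝ (Fin N)} (hω : ‖ω‖ = 1) (ht : -1 < inner ℝ ω (northPole N)) :
    sphericalLaplacian (zonalSeries N l) ω = -(l * zonalSeries N l ω) := by
  have hm := one_le_half_natCast_sub_one hN
  have ht' := inner_northPole_le_one (by omega) hω
  refine (sphericalLaplacian_zonal (norm_northPole (by omega)) hω
    (contDiffAt_gegenbauerSeries_comp hm l ht ht')).trans ?_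
  rw [zonalSeries]
  set t : ℝ := inner ℝ ω (northPole N)
  set m : ℝ := ((N : ℝ) - 1) / 2 with hmN
  have hN2 : (N : ℝ) - 1 = 2 * m := by rw [hmN]; ring
  have habs : ∀ᶠ z : ℝ in 𝓝 t, |1 * ((1 - z) / 2)| < 1 := by
    refine (isOpen_lt (by fun_prop) continuous_const :
      IsOpen {z : ℝ | |1 * ((1 - z) / 2)| < 1}).mem_nhds ?_
    rw [Set.mem_ofPred_eq, abs_lt]
    constructor <;> linarith
  have hl : ∀ z : ℝ, HasDerivAt (fun t : ℝ => (1 - t) / 2) (-1 / 2) z := fun z =>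
    ((hasDerivAt_id z).const_sub 1).div_const 2
  have h1 : deriv (fun t => gegenbauerSeries m l 1 ((1 - t) / 2)) =ᶠ[𝓝 t]
      fun t => gegenbauerDeriv m l 1 ((1 - t) / 2) * (-1 / 2) := by
    filter_upwards [habs] with z hz
    exact ((hasDerivAt_gegenbauerSeries hm hz).comp z (hl z)).deriv
  have h2 := (((hasDerivAt_gegenbauerDeriv (l := l) hm habs.self_of_nhds).comp t (hl t)).mul_const
    (-1 / 2)).deriv
  simp only [Function.comp_def] at h2
  rw [h1.deriv_eq, h1.self_of_nhds, h2, hN2]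
  linear_combination gegenbauerSeries_ode (l := l) hm habs.self_of_nhds

theorem neg_one_lt_cos {γ : ℝ} (h0 : 0 < γ) (hπ : γ < Real.pi) : -1 < Real.cos γ := by
  rw [← Real.cos_pi]
  exact Real.strictAntiOn_cos ⟨h0.le, hπ.le⟩ ⟨Real.pi_pos.le, le_rfl⟩ hπ

theorem contDiffAt_homogeneousExtension_zonalSeries {N : ℕ} (hN : 3 ≤ N) (l : ℝ) {γ : ℝ}
    (h0 : 0 < γ) (hπ : γ < Real.pi) {x : EuclideanSpace ℝ (Fin N)} (hx : x ≠ 0)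
    (hxD : ‖x‖⁻¹ • x ∈ sphericalCap N γ) :
    ContDiffAt ℝ 2 (homogeneousExtension (zonalSeries N l)) x := by
  obtain ⟨h1, h2⟩ := (mem_sphericalCap_iff (by omega) h0 hπ).1 hxD
  exact ContDiffAt.comp x (g := fun t => gegenbauerSeries (((N : ℝ) - 1) / 2) l 1 ((1 - t) / 2))
    (f := fun x => inner ℝ (‖x‖⁻¹ • x) (northPole N))
    (contDiffAt_gegenbauerSeries_comp (one_le_half_natCast_sub_one hN) l
    ((neg_one_lt_cos h0 hπ).trans h2) (inner_northPole_le_one (by omega) h1))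
    (contDiffAt_inner_normalize _ hx)

theorem continuousOn_zonalSeries {N : ℕ} (hN : 3 ≤ N) (l : ℝ) {γ : ℝ} (h0 : 0 < γ)
    (hπ : γ < Real.pi) : ContinuousOn (zonalSeries N l) (closure (sphericalCap N γ)) := by
  intro x hx
  obtain ⟨h1, h2⟩ := closure_sphericalCap_subset (by omega) h0 hπ hx
  refine ContinuousAt.continuousWithinAt ?_
  exact ContinuousAt.comp (f := fun x : EuclideanSpace ℝ (Fin N) => inner ℝ x (northPole N))
    (contDiffAt_gegenbauerSeries_comp (one_le_half_natCast_sub_one hN) l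
      ((neg_one_lt_cos h0 hπ).trans_le h2) (inner_northPole_le_one (by omega) h1)).continuousAt
    (by fun_prop)

/-! ### Lower bound for eigenvalues by comparison, and zonal eigenfunctions. -/

theorem sphericalLaplacian_neg {N : ℕ} (u : EuclideanSpace ℝ (Fin N) → ℝ)
    (ω : EuclideanSpace ℝ (Fin N)) : sphericalLaplacian (-u) ω = -sphericalLaplacian u ω :=
  congrFun (InnerProductSpace.laplacian_neg (f := homogeneousExtension u)) ω

/-- If the zonal solution with parameter `l` is positive on the closed cap, then no Dirichlet
eigenvalue of the cap is below `l`. -/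
theorem le_of_isSphericalDirichletEigenvalue {N : ℕ} (hN : 3 ≤ N) {γ l μ : ℝ} (h0 : 0 < γ)
    (hπ : γ < Real.pi)
    (hpos : ∀ s ∈ Set.Icc 0 ((1 - Real.cos γ) / 2),
      0 < gegenbauerSeries (((N : ℝ) - 1) / 2) l 1 s)
    (hμ : IsSphericalDirichletEigenvalue (sphericalCap N γ) μ) : l ≤ μ := by
  by_contra! hlt
  have hopen := isOpen_setOf_normalize_mem_sphericalCap (N := N) (by omega) h0 hπ
  have hφ : ∀ x ∈ closure (sphericalCap N γ), 0 < zonalSeries N l x := fun x hx => by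
    obtain ⟨h1, h2⟩ := closure_sphericalCap_subset (by omega) h0 hπ hx
    have h3 := inner_northPole_le_one (by omega) h1
    exact hpos _ ⟨by linarith, by linarith⟩
  -- Applied to `u` and to `-u`, this forces `u = 0` on the cap.
  have key : ∀ u : EuclideanSpace ℝ (Fin N) → ℝ,
      ContDiffOn ℝ 2 (homogeneousExtension u) {x | x ≠ 0 ∧ ‖x‖⁻¹ • x ∈ sphericalCap N γ} →
      ContinuousOn u (closure (sphericalCap N γ)) →
      (∀ ω ∈ sphericalCap N γ, -sphericalLaplacian u ω = μ * u ω) →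
      (∀ ω ∈ closure (sphericalCap N γ) \ sphericalCap N γ, u ω = 0) →
      ∀ ω ∈ sphericalCap N γ, u ω ≤ 0 := by
    intro u hu2 huc hue hub ω hω
    by_contra! huω
    obtain ⟨p, hp, hmax⟩ := (isCompact_closure_sphericalCap N γ).exists_isMaxOn
      ⟨ω, subset_closure hω⟩ (huc.div (continuousOn_zonalSeries hN l h0 hπ)
        fun x hx => (hφ x hx).ne')
    set M := u p / zonalSeries N l p with hM
    have hMle : ∀ x ∈ closure (sphericalCap N γ), u x / zonalSeries N l x ≤ M :=
      fun x hx => hmax hx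
    have hM0 : 0 < M :=
      (div_pos huω (hφ ω (subset_closure hω))).trans_le (hMle ω (subset_closure hω))
    have hpD : p ∈ sphericalCap N γ := by
      by_contra hn
      rw [hM, hub p ⟨hp, hn⟩, zero_div] at hM0
      exact lt_irrefl _ hM0
    have hp1 : ‖p‖ = 1 := ((mem_sphericalCap_iff (by omega) h0 hπ).1 hpD).1
    have hpK : p ∈ {x | x ≠ 0 ∧ ‖x‖⁻¹ • x ∈ sphericalCap N γ} :=
      ⟨norm_ne_zero_iff.1 (by rw [hp1]; exact one_ne_zero), by simpa [hp1] using hpD⟩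
    have hup : u p = M * zonalSeries N l p := (div_mul_cancel₀ _ (hφ p hp).ne').symm
    have hcu := hu2.contDiffAt (hopen.mem_nhds hpK)
    have hcφ := contDiffAt_homogeneousExtension_zonalSeries hN l h0 hπ hpK.1 hpK.2
    have hcM : ContDiffAt ℝ 2 (M • homogeneousExtension (zonalSeries N l)) p :=
      contDiffAt_const.smul hcφ
    -- With `φ` the zonal solution and `M` the maximum of `u / φ`, the function `u - M φ` has
    -- maximum `0` at `p`. Its Laplacian there is `(l - μ) u p`, positive if `μ < l`.
    have hloc : IsLocalMax (homogeneousExtension u - M • homogeneousExtension (zonalSeries N l))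
        p := by
      filter_upwards [hopen.mem_nhds hpK] with x hx
      simp only [Pi.sub_apply, Pi.smul_apply, smul_eq_mul,
        homogeneousExtension_apply_of_norm_eq_one _ hp1]
      have hx' := subset_closure hx.2
      have := (div_le_iff₀ (hφ _ hx')).1 (hMle _ hx')
      simp only [homogeneousExtension]
      linarith
    have hlap : Laplacian.laplacian
        (homogeneousExtension u - M • homogeneousExtension (zonalSeries N l)) p ≤ 0 :=
      laplacian_nonpos_of_isLocalMax (hcu.sub hcM) hloc
    rw [hcu.laplacian_sub hcM, InnerProductSpace.laplacian_smul M hcφ] at hlap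
    have e1 := hue p hpD
    have e2 := sphericalLaplacian_zonalSeries hN l hp1
      ((neg_one_lt_cos h0 hπ).trans ((mem_sphericalCap_iff (by omega) h0 hπ).1 hpD).2)
    rw [sphericalLaplacian] at e1 e2
    rw [e2, smul_eq_mul] at hlap
    have : 0 < u p := by rw [hup]; exact mul_pos hM0 (hφ p hp)
    have : 0 < (l - μ) * u p := mul_pos (by linarith) this
    rw [sub_mul, ← e1, hup] at this
    linarith
  obtain ⟨u, hu2, huc, ⟨ω, hω, hne⟩, hue, hub⟩ := hμ
  refine hne (le_antisymm (key u hu2 huc hue hub ω hω) ?_)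
  have := key (-u) hu2.neg huc.neg (fun x hx => by
    rw [sphericalLaplacian_neg, Pi.neg_apply, mul_neg, ← hue x hx])
    (fun x hx => by rw [Pi.neg_apply, hub x hx, neg_zero]) ω hω
  simpa using this

/-- A zonal solution which vanishes on the boundary of the cap is a Dirichlet eigenfunction. -/
theorem isSphericalDirichletEigenvalue_of_eq_zero {N : ℕ} (hN : 3 ≤ N) {γ l : ℝ} (h0 : 0 < γ)
    (hπ : γ < Real.pi)
    (hl : gegenbauerSeries (((N : ℝ) - 1) / 2) l 1 ((1 - Real.cos γ) / 2) = 0) :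
    IsSphericalDirichletEigenvalue (sphericalCap N γ) l := by
  refine ⟨zonalSeries N l, fun x hx =>
    (contDiffAt_homogeneousExtension_zonalSeries hN l h0 hπ hx.1 hx.2).contDiffWithinAt,
    continuousOn_zonalSeries hN l h0 hπ,
    ⟨northPole N, northPole_mem_sphericalCap (by omega) h0 hπ, ?_⟩, fun ω hω => ?_, fun ω hω => ?_⟩
  · rw [zonalSeries, real_inner_self_eq_norm_sq, norm_northPole (by omega), one_pow, sub_self,
      zero_div, gegenbauerSeries_zero]
    exact one_ne_zero
  · obtain ⟨h1, h2⟩ := (mem_sphericalCap_iff (by omega) h0 hπ).1 hω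
    rw [sphericalLaplacian_zonalSeries hN l h1 ((neg_one_lt_cos h0 hπ).trans h2), neg_neg]
  · obtain ⟨h1, h2⟩ := closure_sphericalCap_subset (by omega) h0 hπ hω.1
    have h3 : inner ℝ ω (northPole N) = Real.cos γ := le_antisymm
      (not_lt.1 fun h => hω.2 ((mem_sphericalCap_iff (by omega) h0 hπ).2 ⟨h1, h⟩)) h2
    rw [zonalSeries, h3, hl]

/-! ### The first eigenvalue as a critical parameter. -/

/-- Joint continuity and compactness of `[0, R]` make positivity on the interval an open condition
on the parameters. -/
theorem eventually_forall_gegenbauerSeries_pos {m l ε R : ℝ} (hm : 1 ≤ m) (hε : 0 ≤ ε)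
    (hR : ε * R < 1) (hpos : ∀ y ∈ Set.Icc 0 R, 0 < gegenbauerSeries m l ε y) :
    ∀ᶠ p : ℝ × ℝ in 𝓝 (l, ε), ∀ y ∈ Set.Icc 0 R, 0 < gegenbauerSeries m p.1 p.2 y := by
  refine isCompact_Icc.eventually_forall_of_forall_eventually
    (P := fun (p : ℝ × ℝ) y => 0 < gegenbauerSeries m p.1 p.2 y) fun y hy => ?_
  have habs : |ε * y| < 1 := by
    rw [abs_of_nonneg (mul_nonneg hε hy.1)]
    exact (mul_le_mul_of_nonneg_left hy.2 hε).trans_lt hR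
  have h : ContinuousAt (fun z : (ℝ × ℝ) × ℝ => gegenbauerSeries m z.1.1 z.1.2 z.2) ((l, ε), y) :=
    ContinuousAt.comp (x := ((l, ε), y)) (f := fun z : (ℝ × ℝ) × ℝ => (z.1.1, z.1.2, z.2))
      (g := fun p : ℝ × ℝ × ℝ => gegenbauerSeries m p.1 p.2.1 p.2.2)
      (continuousAt_gegenbauerSeries (p := (l, ε, y)) hm habs) (by fun_prop)
  exact h.eventually_const_lt (hpos y hy)

theorem gegenbauerSeries_div_one {m l c y : ℝ} (hc : c ≠ 0) :
    gegenbauerSeries m (l / c) 1 (c * y) = gegenbauerSeries m l c y := by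
  rw [← gegenbauerSeries_scale, mul_div_cancel₀ _ hc, mul_one]

/-- The smallest parameter for which the series in `s` with `ε = 1` has a zero in `[0, S]`:
the zero is then at `S`. -/
theorem exists_first_parameter {m S : ℝ} (hm : 1 ≤ m) (hS : 0 < S) (hS1 : S < 1) :
    ∃ l, 0 < l ∧ gegenbauerSeries m l 1 S = 0 ∧
      ∀ l', 0 ≤ l' → l' < l → ∀ s ∈ Set.Icc 0 S, 0 < gegenbauerSeries m l' 1 s := by
  have hS' : 1 * S < 1 := by linarith
  set A : Set ℝ := Set.Ici 0 ∩ {l | ∀ s ∈ Set.Icc 0 S, 0 < gegenbauerSeries m l 1 s}ᶜ with hA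
  have hAmem : ∀ {l s : ℝ}, 0 ≤ l → s ∈ Set.Icc 0 S → gegenbauerSeries m l 1 s ≤ 0 → l ∈ A :=
    fun hl hs h => ⟨hl, fun hn => (hn _ hs).not_ge h⟩
  have hcl : IsClosed A := by
    refine isClosed_Ici.inter (IsOpen.isClosed_compl ?_)
    refine isOpen_iff_mem_nhds.2 fun l hl => ?_
    have hc : ContinuousAt (fun l : ℝ => (l, (1 : ℝ))) l := by fun_prop
    exact hc.eventually (eventually_forall_gegenbauerSeries_pos hm zero_le_one hS' hl)
  -- The Bessel series is negative just past its first zero, and remains so at that `y` for small `ε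
  -- > 0`. Scaling back to `ε = 1` gives a negative value at `ε y < S` for the parameter `1 / ε`.
  have hne : A.Nonempty := by
    obtain ⟨y₀, hy₀, hz, hp⟩ := exists_first_zero_gegenbauerSeries hm
    obtain ⟨y, hy, hneg⟩ := exists_gegenbauerSeries_neg hm one_pos le_rfl hy₀ (by simp) hz hp
      (lt_add_one y₀)
    have hy0 : 0 < y := hy₀.trans hy.1
    have hc : ContinuousAt (fun ε : ℝ => gegenbauerSeries m 1 ε y) 0 :=
      ContinuousAt.comp (f := fun ε : ℝ => ((1 : ℝ), ε, y))
        (continuousAt_gegenbauerSeries (p := (1, 0, y)) hm (by simp)) (by fun_prop)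
    have hc2 : ContinuousAt (fun ε : ℝ => ε * y) 0 := by fun_prop
    have h1 := (hc.eventually_lt_const hneg).and
      (hc2.eventually_lt_const (show 0 * y < S by simpa using hS))
    obtain ⟨ε, ⟨h2, h3⟩, hε⟩ := ((h1.filter_mono nhdsWithin_le_nhds).and
      (self_mem_nhdsWithin : Set.Ioi (0 : ℝ) ∈ 𝓝[>] 0)).exists
    have hε : 0 < ε := hε
    refine ⟨1 / ε, hAmem (by positivity) (s := ε * y) ⟨by positivity, h3.le⟩ ?_⟩
    rw [gegenbauerSeries_div_one hε.ne']
    exact h2.le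
  have hbd : BddBelow A := ⟨0, fun l hl => hl.1⟩
  have hmem := hcl.csInf_mem hne hbd
  set l := sInf A
  have hlow : ∀ l', 0 ≤ l' → l' < l → ∀ s ∈ Set.Icc 0 S, 0 < gegenbauerSeries m l' 1 s := by
    intro l' hl' hlt s hs
    by_contra! hn
    exact (csInf_le hbd (hAmem hl' hs hn)).not_gt hlt
  have hl0 : 0 < l := by
    refine lt_of_le_of_ne hmem.1 fun h => hmem.2 fun s _ => ?_
    rw [← h, gegenbauerSeries_zero_left]
    exact one_pos
  refine ⟨l, hl0, ?_, hlow⟩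
  obtain ⟨s, hs, hsn⟩ : ∃ s ∈ Set.Icc 0 S, gegenbauerSeries m l 1 s ≤ 0 := by
    by_contra! hn
    exact hmem.2 hn
  obtain ⟨s₀, hs₀, hz, hp⟩ := exists_first_zero hs.1
    (continuousOn_gegenbauerSeries hm zero_le_one (by linarith [hs.2]))
    (by simp [gegenbauerSeries_zero]) hsn
  -- If the first zero lay before `S`, the series would be negative just after it, and still
  -- negative there for slightly smaller `l`, against minimality.
  obtain hlt | heq := (hs₀.2.trans hs.2).lt_or_eq
  · exfalso
    obtain ⟨s₁, hs₁, hneg⟩ := exists_gegenbauerSeries_neg hm hl0 zero_le_one hs₀.1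
      (by linarith) hz hp hlt
    have hs₁0 : 0 < s₁ := hs₀.1.trans hs₁.1
    have hc : ContinuousAt (fun l : ℝ => gegenbauerSeries m l 1 s₁) l :=
      ContinuousAt.comp (f := fun l : ℝ => (l, (1 : ℝ), s₁))
        (continuousAt_gegenbauerSeries (p := (l, 1, s₁)) hm (by
          rw [one_mul, abs_of_pos hs₁0]; linarith [hs₁.2])) (by fun_prop)
    obtain ⟨l', h1, h2⟩ := (((hc.eventually_lt_const hneg).filter_mono nhdsWithin_le_nhds).and
      (Ioo_mem_nhdsLT hl0)).exists
    exact absurd h1 (hlow l' h2.1.le h2.2 s₁ ⟨hs₁0.le, hs₁.2.le⟩).not_gt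
  · rwa [← heq]

theorem half_one_sub_cos_mem_Ioo {γ : ℝ} (h0 : 0 < γ) (hπ : γ < Real.pi) :
    (1 - Real.cos γ) / 2 ∈ Set.Ioo (0 : ℝ) 1 := by
  have h1 := neg_one_lt_cos h0 hπ
  have h2 : Real.cos γ < 1 := by
    rw [← Real.cos_zero]
    exact Real.strictAntiOn_cos ⟨le_rfl, Real.pi_pos.le⟩ ⟨h0.le, hπ.le⟩ h0
  constructor <;> linarith

/-- The first cap eigenvalue is the smallest parameter for which the zonal solution vanishes
somewhere on the closed cap. -/
theorem firstCapEigenvalue_spec {N : ℕ} (hN : 3 ≤ N) {γ : ℝ} (h0 : 0 < γ) (hπ : γ < Real.pi) :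
    IsLeast {μ : ℝ | IsSphericalDirichletEigenvalue (sphericalCap N γ) μ}
        (firstCapEigenvalue N γ) ∧
      ∀ l, 0 ≤ l → l < firstCapEigenvalue N γ → ∀ s ∈ Set.Icc 0 ((1 - Real.cos γ) / 2),
        0 < gegenbauerSeries (((N : ℝ) - 1) / 2) l 1 s := by
  obtain ⟨hS, hS1⟩ := half_one_sub_cos_mem_Ioo h0 hπ
  obtain ⟨l, hl0, hz, hlow⟩ := exists_first_parameter (one_le_half_natCast_sub_one hN) hS hS1
  have hleast : IsLeast {μ : ℝ | IsSphericalDirichletEigenvalue (sphericalCap N γ) μ} l := by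
    refine ⟨isSphericalDirichletEigenvalue_of_eq_zero hN h0 hπ hz, fun μ hμ => ?_⟩
    by_contra! hlt
    -- The maximum with `0` is needed because positivity is known only for nonnegative parameters.
    obtain ⟨l', h1, h2⟩ := exists_between (max_lt hlt hl0)
    exact (le_of_isSphericalDirichletEigenvalue hN h0 hπ
      (hlow l' ((le_max_right _ _).trans h1.le) h2) hμ).not_gt ((le_max_left _ _).trans_lt h1)
  have heq : firstCapEigenvalue N γ = l := hleast.csInf_eq
  rw [heq]
  exact ⟨hleast, hlow⟩

/-! ### The limit of small caps. -/

theorem gegenbauerSeries_eps_zero (m q y : ℝ) :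
    gegenbauerSeries m q 0 y = gegenbauerSeries m 1 0 (q * y) := by
  simpa using gegenbauerSeries_scale m 1 0 q y

theorem tendsto_sq_nhdsGT_zero : Tendsto (fun γ : ℝ => γ ^ 2) (𝓝[>] 0) (𝓝 0) := by
  have : Tendsto (fun γ : ℝ => γ ^ 2) (𝓝 0) (𝓝 (0 ^ 2)) := (continuous_pow 2).tendsto 0
  simpa using this.mono_left nhdsWithin_le_nhds

/-- The limit series with parameter `q` is positive on `[0, 1 / 4]`, hence so is the series with `ε
= γ ^ 2` for small `γ`. Since `(1 - cos γ) / 2 ≤ γ ^ 2 / 4`, the zonal solution with `l = q / γ ^ 2`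
is then positive on the closed cap. -/
theorem eventually_le_firstCapEigenvalue {N : ℕ} (hN : 3 ≤ N) {q Y : ℝ} (hq : 0 < q)
    (hqY : q / 4 < Y)
    (hpos : ∀ y ∈ Set.Ico 0 Y, 0 < gegenbauerSeries (((N : ℝ) - 1) / 2) 1 0 y) :
    ∀ᶠ γ in 𝓝[>] 0, q ≤ firstCapEigenvalue N γ * γ ^ 2 := by
  have hm := one_le_half_natCast_sub_one hN
  have hpos0 : ∀ y ∈ Set.Icc 0 (1 / 4 : ℝ), 0 < gegenbauerSeries (((N : ℝ) - 1) / 2) q 0 y := by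
    intro y hy
    rw [gegenbauerSeries_eps_zero]
    exact hpos _ ⟨mul_nonneg hq.le hy.1, by nlinarith [hy.2]⟩
  have hc : Tendsto (fun γ : ℝ => (q, γ ^ 2)) (𝓝[>] 0) (𝓝 (q, 0)) :=
    tendsto_const_nhds.prodMk_nhds tendsto_sq_nhdsGT_zero
  filter_upwards [hc.eventually (eventually_forall_gegenbauerSeries_pos hm le_rfl (by simp) hpos0),
    Ioo_mem_nhdsGT Real.pi_pos] with γ hγ hI
  have hγ2 : 0 < γ ^ 2 := pow_pos hI.1 2
  rw [← div_le_iff₀ hγ2]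
  refine le_of_isSphericalDirichletEigenvalue hN hI.1 hI.2 (fun s hs => ?_)
    (firstCapEigenvalue_spec hN hI.1 hI.2).1.1
  have hs4 : s / γ ^ 2 ≤ 1 / 4 := by
    rw [div_le_iff₀ hγ2]
    linarith [hs.2, Real.one_sub_sq_div_two_le_cos (x := γ)]
  have := hγ (s / γ ^ 2) ⟨div_nonneg hs.1 hγ2.le, hs4⟩
  rwa [← gegenbauerSeries_div_one hγ2.ne', mul_div_cancel₀ _ hγ2.ne'] at this

/-- A negative value of the limit series at `z / q < 1 / 4` persists for `ε = γ ^ 2`. The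
corresponding point `s = γ ^ 2 z / q` lies in the cap, so `q / γ ^ 2` cannot be below the first
eigenvalue. -/
theorem eventually_firstCapEigenvalue_le {N : ℕ} (hN : 3 ≤ N) {q z : ℝ} (hz : 0 < z)
    (hzq : z < q / 4) (hneg : gegenbauerSeries (((N : ℝ) - 1) / 2) 1 0 z < 0) :
    ∀ᶠ γ in 𝓝[>] 0, firstCapEigenvalue N γ * γ ^ 2 ≤ q := by
  have hm := one_le_half_natCast_sub_one hN
  have hq : 0 < q := by linarith
  have hy0 : 0 < z / q := div_pos hz hq
  have hy4 : z / q < 1 / 4 := by rw [div_lt_iff₀ hq]; linarith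
  have hneg0 : gegenbauerSeries (((N : ℝ) - 1) / 2) q 0 (z / q) < 0 := by
    rwa [gegenbauerSeries_eps_zero, mul_div_cancel₀ _ hq.ne']
  have hc : Tendsto (fun γ : ℝ => gegenbauerSeries (((N : ℝ) - 1) / 2) q (γ ^ 2) (z / q))
      (𝓝[>] 0) (𝓝 (gegenbauerSeries (((N : ℝ) - 1) / 2) q 0 (z / q))) :=
    (continuousAt_gegenbauerSeries (p := (q, 0, z / q)) hm (by simp)).tendsto.comp
      (tendsto_const_nhds.prodMk_nhds (tendsto_sq_nhdsGT_zero.prodMk_nhds tendsto_const_nhds))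
  have h4 : 0 < 1 / 4 - z / q := by linarith
  filter_upwards [hc.eventually_lt_const hneg0, tendsto_sq_nhdsGT_zero.eventually_lt_const h4,
    Ioo_mem_nhdsGT (show (0 : ℝ) < 1 by norm_num)] with γ hγ hγ4 hI
  have hπ : γ < Real.pi := hI.2.trans (by linarith [Real.pi_gt_three])
  have hγ2 : 0 < γ ^ 2 := pow_pos hI.1 2
  rw [← le_div_iff₀ hγ2]
  by_contra! hlt
  -- The condition `γ ^ 2 < 1 / 4 - z / q` absorbs the quartic error in the expansion of the cosine.
  have hs : γ ^ 2 * (z / q) ≤ (1 - Real.cos γ) / 2 := by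
    have hb := (abs_le.1 (Real.cos_bound (x := γ) (by rw [abs_of_pos hI.1]; exact hI.2.le))).2
    rw [abs_of_pos hI.1] at hb
    nlinarith
  have := (firstCapEigenvalue_spec hN hI.1 hπ).2 (q / γ ^ 2) (by positivity) hlt
    (γ ^ 2 * (z / q)) ⟨by positivity, hs⟩
  rw [gegenbauerSeries_div_one hγ2.ne'] at this
  exact this.not_gt hγ

theorem mainTheorem9 (N : ℕ) (hN : 3 ≤ N) :
    (∀ γ : ℝ, 0 < γ → γ < Real.pi →
      IsLeast {μ : ℝ | IsSphericalDirichletEigenvalue (sphericalCap N γ) μ}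
        (firstCapEigenvalue N γ)) ∧
    ∃ B₁ : ℝ, IsLeast {x : ℝ | 0 < x ∧ besselJ (((N : ℝ) - 3) / 2) x = 0} B₁ ∧
      Tendsto (fun γ : ℝ => firstCapEigenvalue N γ * γ ^ 2 / B₁ ^ 2) (𝓝[>] 0) (𝓝 1) := by
  refine ⟨fun γ h0 hπ => (firstCapEigenvalue_spec hN h0 hπ).1, ?_⟩
  have hm := one_le_half_natCast_sub_one hN
  obtain ⟨B, hB0, hB, hz, hpos⟩ := isLeast_besselJ_zero hm
  have hν : ((N : ℝ) - 1) / 2 - 1 = ((N : ℝ) - 3) / 2 := by ring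
  rw [hν] at hB
  refine ⟨B, hB, ?_⟩
  have hB2 : 0 < B ^ 2 := by positivity
  have hlim : Tendsto (fun γ : ℝ => firstCapEigenvalue N γ * γ ^ 2) (𝓝[>] 0) (𝓝 (B ^ 2)) := by
    refine tendsto_order.2 ⟨fun a ha => ?_, fun b hb => ?_⟩
    -- The bound `a` may be negative, while the lower estimate needs `q > 0`.
    · obtain ⟨q, h1, h2⟩ := exists_between (max_lt ha hB2)
      filter_upwards [eventually_le_firstCapEigenvalue hN ((le_max_right _ _).trans_lt h1)
        (show q / 4 < B ^ 2 / 4 by linarith) hpos] with γ hγ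
      exact ((le_max_left _ _).trans_lt h1).trans_le hγ
    · obtain ⟨q, h1, h2⟩ := exists_between hb
      obtain ⟨z, hzI, hneg⟩ := exists_gegenbauerSeries_neg hm one_pos le_rfl
        (show 0 < B ^ 2 / 4 by positivity) (by simp) hz hpos (show B ^ 2 / 4 < q / 4 by linarith)
      filter_upwards [eventually_firstCapEigenvalue_le hN
        ((show 0 < B ^ 2 / 4 by positivity).trans hzI.1) hzI.2 hneg] with γ hγ
      exact hγ.trans_lt h2
  have := hlim.div_const (B ^ 2)
  rwa [div_self hB2.ne'] at this
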